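/- Let $\mathbf R$ be the random graph, i.e. the countable Fraïssé limit of the class of all finite graphs, and let $\mathrm{Aut}(\mathbf R)$ carry the topology of pointwise convergence on the discrete vertex set of $\mathbf R$. Let $\Gamma$ be a discrete group which is either finitely generated abelian or finitely generated free. Let $\mathsf{Rep}(\Gamma,\mathbf R)$ be the space of all homomorphisms $\pi\colon\Gamma\to\mathrm{Aut}(\mathbf R)$, with the topology of pointwise convergence on $\Gamma$ (equivalently, on any generating set of $\Gamma$), on which $\mathrm{Aut}(\mathbf R)$ acts by conjugation, $(g\cdot\pi)(\gamma)=g\,\pi(\gamma)\,g^{-1}$. Then there is a cyclically dense representation of $\Gamma$ on $\mathbf R$: there are $g\in\mathrm{Aut}(\mathbf R)$ and $\pi\in\mathsf{Rep}(\Gamma,\mathbf R)$ such that the set $\{g^k\cdot\pi : k\in\mathbb Z\}$ is dense in $\mathsf{Rep}(\Gamma,\mathbf R)$. Moreover, $g$ can be chosen to be transitive, i.e. such that the cyclic group generated by $g$ acts transitively on the vertices of $\mathbf R$. -/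

import Mathlib

universe u

/-- The class of all finite graphs, as structures in the language of one binary relation:
finite structures whose relation is symmetric and irreflexive. -/
def finiteGraphs : Set (CategoryTheory.Bundled.{u} FirstOrder.Language.graph.Structure) :=
  {N | Finite N ∧ (N : Type u) ⊨ FirstOrder.Language.Theory.simpleGraph}

/-- `R` is the random graph: the (countable) Fraïssé limit of the class of all finite graphs.
It is unique up to isomorphism. -/
def IsRandomGraph {V : Type u} (R : SimpleGraph V) : Prop :=
  letI : FirstOrder.Language.graph.Structure V := R.structure
  ∃ _ : Countable V, FirstOrder.Language.IsFraisseLimit finiteGraphs.{u} V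

/-- The topology of pointwise convergence on the automorphism group of a graph, the vertex set
being discrete: the coarsest topology for which all maps `g ↦ g x` to the discrete space of
vertices are continuous. -/
instance autTopology {V : Type*} (R : SimpleGraph V) : TopologicalSpace (R ≃g R) :=
  TopologicalSpace.induced (fun (g : R ≃g R) (x : V) => g x)
    (@Pi.topologicalSpace V (fun _ => V) (fun _ => ⊥))

/-- The space `Rep(Γ, A)` of representations of the discrete group `Γ` in the topological
group `A`, that is, of homomorphisms from `Γ` to `A`. -/
def RepSpace (Γ A : Type*) [Group Γ] [Group A] : Type _ := Γ →* A

namespace RepSpace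

variable {Γ A : Type*} [Group Γ] [Group A]

instance : FunLike (RepSpace Γ A) Γ A := inferInstanceAs (FunLike (Γ →* A) Γ A)

instance : MonoidHomClass (RepSpace Γ A) Γ A := inferInstanceAs (MonoidHomClass (Γ →* A) Γ A)

/-- `Rep(Γ, A)` is a subspace of the product `A ^ Γ`, a representation being given by its values
on the generating set `Γ` of `Γ`; any other generating set yields the same topology
when `A` is a topological group. -/
instance [TopologicalSpace A] : TopologicalSpace (RepSpace Γ A) :=
  TopologicalSpace.induced (fun (π : RepSpace Γ A) (γ : Γ) => π γ) Pi.topologicalSpace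

/-- The conjugate `γ ↦ g * π γ * g⁻¹` of a representation `π` by `g`. -/
def conj (g : A) (π : RepSpace Γ A) : RepSpace Γ A :=
  MonoidHom.mk' (fun γ => g * π γ * g⁻¹) fun γ δ => by rw [map_mul]; group

/-- The action of `A` on `Rep(Γ, A)` by conjugation. -/
instance : MulAction A (RepSpace Γ A) where
  smul := conj
  one_smul π := DFunLike.ext _ _ fun γ => by
    change 1 * π γ * 1⁻¹ = π γ
    group
  mul_smul g h π := DFunLike.ext _ _ fun γ => by
    change g * h * π γ * (g * h)⁻¹ = g * (h * π γ * h⁻¹) * g⁻¹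
    group

/-- The representation `π` is cyclically dense, with witness `g`: the set `{g ^ k • π}`, where
`k` runs over the integers, is dense in `Rep(Γ, A)`. (A representation is called cyclically dense
if it has such a witness.) -/
def IsCyclicallyDenseVia [TopologicalSpace A] (g : A) (π : RepSpace Γ A) : Prop :=
  Dense (Set.range fun k : ℤ => g ^ k • π)

end RepSpace

/-- An automorphism `g` is transitive if the cyclic group it generates acts transitively on the
vertices. -/
def IsTransitiveAut {V : Type*} {R : SimpleGraph V} (g : R ≃g R) : Prop :=
  ∀ x y : V, ∃ k : ℤ, (g ^ k) x = y

open Equiv FirstOrder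

/-! The random graph is realized on `ℤ` as a difference graph, so that translation by 1 is a
transitive automorphism `g`. The set `S` of distances and an action `π` of `Γ` are built together,
generically, from finite approximations. Conjugating `π` by `g ^ (-k)` gives `x ↦ π γ (x + k) - k`.
Density therefore says that every finite piece of every action `π'` of `Γ` on the graph occurs in
`π`, shifted by some `k`.

Such a piece can be added to a finite approximation as soon as it embeds in an action on a finite
graph: that graph is placed far away, at fresh distances (`exists_le_translate`). What the group
must supply is `IsFinitelyRealizable`. For finitely generated abelian groups it follows from
subgroups being closed in the profinite topology, by passing to a finite quotient. For free groups
it follows from the extension property for partial automorphisms of finite graphs, applied to each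
generator separately. Finally, a back-and-forth argument carries the construction over to the given
copy of the random graph. -/

/-! ### Difference graphs and placement of finite graphs in them -/

/-- The graph on the integers in which adjacency depends only on the distance, the distances of
adjacent integers being the nonzero members of `S`. -/
def differenceGraph (S : Set ℕ) : SimpleGraph ℤ where
  Adj x y := x ≠ y ∧ (x - y).natAbs ∈ S
  symm := ⟨fun x y h => ⟨h.1.symm, by rw [← Int.natAbs_neg, neg_sub]; exact h.2⟩⟩
  loopless := ⟨fun _ h => h.1 rfl⟩

theorem differenceGraph_adj {S : Set ℕ} {x y : ℤ} :
    (differenceGraph S).Adj x y ↔ x ≠ y ∧ (x - y).natAbs ∈ S := Iff.rfl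

theorem differenceGraph_adj_add_right {S : Set ℕ} (x y k : ℤ) :
    (differenceGraph S).Adj (x + k) (y + k) ↔ (differenceGraph S).Adj x y := by
  simp [differenceGraph_adj]

theorem differenceGraph_adj_congr {S S' : Set ℕ} {N : ℕ} (h : ∀ d ≤ N, d ∈ S' ↔ d ∈ S) {x y : ℤ}
    (hxy : (x - y).natAbs ≤ N) : (differenceGraph S').Adj x y ↔ (differenceGraph S).Adj x y := by
  simp [differenceGraph_adj, h _ hxy]

theorem exists_natAbs_sub_le (E : Finset ℤ) :
    ∃ B : ℕ, ∀ x ∈ E, ∀ y ∈ E, (x - y).natAbs ≤ B := by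
  refine ⟨(E ×ˢ E).sup fun p => (p.1 - p.2).natAbs, fun x hx y hy => ?_⟩
  exact Finset.le_sup (f := fun p : ℤ × ℤ => (p.1 - p.2).natAbs)
    (Finset.mk_mem_product hx hy)

/-- Any prescribed adjacency to a finite set of integers can be achieved by an integer outside
it, the set of distances being changed only at large distances. -/
theorem exists_differenceGraph_adj_iff (S : Set ℕ) (N : ℕ) (E : Finset ℤ) (P : ℤ → Prop) :
    ∃ (S' : Set ℕ) (M : ℤ), (∀ d ≤ N, d ∈ S' ↔ d ∈ S) ∧ M ∉ E ∧
      ∀ x ∈ E, (differenceGraph S').Adj M x ↔ P x := by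
  obtain ⟨B, hB⟩ : ∃ B : ℕ, ∀ x ∈ E, x.natAbs ≤ B :=
    ⟨E.sup Int.natAbs, fun x hx => Finset.le_sup hx⟩
  -- Since `|x| ≤ B` on `E`, the distances `N + B + 1 - x` exceed `N` and are distinct for distinct
  -- `x`. They are thus undecided, and each one determines its `x`.
  refine ⟨{d | d ≤ N ∧ d ∈ S ∨ N < d ∧ P ((N + B + 1 : ℤ) - d)}, N + B + 1, ?_, ?_, ?_⟩
  · intro d hd
    simp [hd, not_lt.2 hd]
  · intro h
    have := hB _ h
    omega
  · intro x hx
    have h1 := hB x hx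
    have h2 : (((N + B + 1 - x : ℤ).natAbs : ℕ) : ℤ) = N + B + 1 - x := by omega
    have h3 : N < (N + B + 1 - x : ℤ).natAbs := by omega
    have h4 : (N + B + 1 : ℤ) ≠ x := by omega
    rw [differenceGraph_adj, Set.mem_ofPred_eq, h2, sub_sub_cancel]
    simp [h3, not_le.2 h3, h4]

/-- A finite graph with a placed part can be placed entirely in a difference graph. -/
theorem exists_placement {Y : Type*} [DecidableEq Y] (G : SimpleGraph Y) (s : Finset Y)
    (e : Y → ℤ) (S : Set ℕ) (N : ℕ) (inj : Set.InjOn e s)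
    (adj : ∀ a ∈ s, ∀ b ∈ s, (differenceGraph S).Adj (e a) (e b) ↔ G.Adj a b)
    (bound : ∀ a ∈ s, ∀ b ∈ s, (e a - e b).natAbs ≤ N) (t : Finset Y) :
    ∃ (S' : Set ℕ) (N' : ℕ) (e' : Y → ℤ), N ≤ N' ∧ (∀ d ≤ N, d ∈ S' ↔ d ∈ S) ∧
      (∀ a ∈ s, e' a = e a) ∧ Set.InjOn e' (s ∪ t : Finset Y) ∧
      (∀ a ∈ s ∪ t, ∀ b ∈ s ∪ t, (differenceGraph S').Adj (e' a) (e' b) ↔ G.Adj a b) ∧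
      ∀ a ∈ s ∪ t, ∀ b ∈ s ∪ t, (e' a - e' b).natAbs ≤ N' := by
  induction t using Finset.induction_on with
  | empty => exact ⟨S, N, e, le_rfl, by simp, by simp, by simpa using inj, by simpa using adj,
      by simpa using bound⟩
  | insert c t hc ih =>
    obtain ⟨S', N', e', hN, hS, he, hinj, hadj, hbound⟩ := ih
    rw [Finset.union_insert]
    by_cases hcs : c ∈ s ∪ t
    · rw [Finset.insert_eq_of_mem hcs]
      exact ⟨S', N', e', hN, hS, he, hinj, hadj, hbound⟩
    obtain ⟨S'', M, hS', hM, hP⟩ := exists_differenceGraph_adj_iff S' N' ((s ∪ t).image e')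
      fun x => ∃ b ∈ s ∪ t, e' b = x ∧ G.Adj c b
    obtain ⟨B, hB⟩ := exists_natAbs_sub_le ((insert c (s ∪ t)).image (Function.update e' c M))
    have hne : ∀ a ∈ s ∪ t, a ≠ c := fun a ha h => hcs (h ▸ ha)
    have hup : ∀ a ∈ s ∪ t, Function.update e' c M a = e' a := fun a ha =>
      Function.update_of_ne (hne a ha) _ _
    have hMne : ∀ a ∈ s ∪ t, e' a ≠ M := fun a ha h => hM (h ▸ Finset.mem_image_of_mem _ ha)
    have hcadj : ∀ b ∈ s ∪ t, (differenceGraph S'').Adj M (e' b) ↔ G.Adj c b := by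
      intro b hb
      rw [hP _ (Finset.mem_image_of_mem _ hb)]
      exact ⟨fun ⟨b', hb', h, h'⟩ => hinj hb' hb h ▸ h', fun h => ⟨b, hb, rfl, h⟩⟩
    refine ⟨S'', max N' B, Function.update e' c M, hN.trans (le_max_left _ _), ?_, ?_, ?_, ?_, ?_⟩
    · exact fun d hd => (hS' d (hd.trans hN)).trans (hS d hd)
    · exact fun a ha => (hup a (Finset.mem_union_left _ ha)).trans (he a ha)
    · intro a ha b hb hab
      rw [Finset.mem_coe, Finset.mem_insert] at ha hb
      rcases ha with rfl | ha <;> rcases hb with rfl | hb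
      · rfl
      · rw [hup b hb, Function.update_self] at hab
        exact absurd hab.symm (hMne b hb)
      · rw [hup a ha, Function.update_self] at hab
        exact absurd hab (hMne a ha)
      · rw [hup a ha, hup b hb] at hab
        exact hinj ha hb hab
    · intro a ha b hb
      rw [Finset.mem_insert] at ha hb
      rcases ha with rfl | ha <;> rcases hb with rfl | hb
      · simp
      · rw [hup b hb, Function.update_self, hcadj b hb]
      · rw [hup a ha, Function.update_self, SimpleGraph.adj_comm, hcadj a ha,
          SimpleGraph.adj_comm]
      · rw [hup a ha, hup b hb, differenceGraph_adj_congr hS' (hbound a ha b hb), hadj a ha b hb]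
    · exact fun a ha b hb => (hB _ (Finset.mem_image_of_mem _ ha) _
        (Finset.mem_image_of_mem _ hb)).trans (le_max_right _ _)

/-! ### Finite approximations and their extensions -/

/-- A finite approximation of a difference graph together with an action of `Γ` on it: distances
up to `N` are decided by `S`, and `ρ` describes an action on the finite set `X`. -/
structure GraphActionApprox (Γ : Type*) [Group Γ] where
  N : ℕ
  S : Set ℕ
  X : Finset ℤ
  ρ : Γ →* Perm ℤ
  map_mem : ∀ γ, ∀ x ∈ X, ρ γ x ∈ X
  bound : ∀ x ∈ X, ∀ y ∈ X, (x - y).natAbs ≤ N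
  adj : ∀ γ, ∀ x ∈ X, ∀ y ∈ X,
    (differenceGraph S).Adj (ρ γ x) (ρ γ y) ↔ (differenceGraph S).Adj x y

namespace GraphActionApprox

variable {Γ : Type*} [Group Γ]

/-- Only distances up to `N` and the values of `ρ` on `X` are binding; the rest of `S` and `ρ` is
provisional. -/
instance : Preorder (GraphActionApprox Γ) where
  le p q := p.N ≤ q.N ∧ (∀ d ≤ p.N, d ∈ q.S ↔ d ∈ p.S) ∧ p.X ⊆ q.X ∧
    ∀ γ, ∀ x ∈ p.X, q.ρ γ x = p.ρ γ x
  le_refl p := ⟨le_rfl, fun _ _ => Iff.rfl, subset_rfl, fun _ _ _ => rfl⟩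
  le_trans p q r h h' := ⟨h.1.trans h'.1,
    fun d hd => (h'.2.1 d (hd.trans h.1)).trans (h.2.1 d hd), h.2.2.1.trans h'.2.2.1,
    fun γ x hx => (h'.2.2.2 γ x (h.2.2.1 hx)).trans (h.2.2.2 γ x hx)⟩

/-- The approximation obtained by deciding more distances. -/
def changeDistances (p : GraphActionApprox Γ) (N : ℕ) (S : Set ℕ) (hN : p.N ≤ N)
    (hS : ∀ d ≤ p.N, d ∈ S ↔ d ∈ p.S) : GraphActionApprox Γ where
  N := N
  S := S
  X := p.X
  ρ := p.ρ
  map_mem := p.map_mem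
  bound x hx y hy := (p.bound x hx y hy).trans hN
  adj γ x hx y hy := by
    rw [differenceGraph_adj_congr hS (p.bound x hx y hy), differenceGraph_adj_congr hS
      (p.bound _ (p.map_mem γ x hx) _ (p.map_mem γ y hy)), p.adj γ x hx y hy]

theorem le_changeDistances (p : GraphActionApprox Γ) (N : ℕ) (S : Set ℕ) (hN : p.N ≤ N)
    (hS : ∀ d ≤ p.N, d ∈ S ↔ d ∈ p.S) : p ≤ p.changeDistances N S hN hS :=
  ⟨hN, hS, subset_rfl, fun _ _ _ => rfl⟩

/-- A finite graph with an action of `Γ` that contains the given approximation and is partly placed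
can be placed entirely. -/
theorem exists_le_of_finite (p : GraphActionApprox Γ) {Y : Type*} [Finite Y] (G : SimpleGraph Y)
    (σ : Γ →* Perm Y) (hσ : ∀ γ a b, G.Adj (σ γ a) (σ γ b) ↔ G.Adj a b) (s : Finset Y)
    (e : Y → ℤ) (inj : Set.InjOn e s)
    (adj : ∀ a ∈ s, ∀ b ∈ s, (differenceGraph p.S).Adj (e a) (e b) ↔ G.Adj a b)
    (hX : ∀ x ∈ p.X, ∃ a ∈ s, e a = x ∧ ∀ γ, σ γ a ∈ s ∧ e (σ γ a) = p.ρ γ x) :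
    ∃ q, p ≤ q ∧ ∃ e' : Y → ℤ, (∀ a ∈ s, e' a = e a) ∧ (∀ a, e' a ∈ q.X) ∧
      ∀ γ a, q.ρ γ (e' a) = e' (σ γ a) := by
  classical
  have := Fintype.ofFinite Y
  obtain ⟨B, hB⟩ := exists_natAbs_sub_le (s.image e)
  -- Vertices of `s` may lie outside `p.X`, at undecided distances; the bound `max p.N B` freezes
  -- these too.
  obtain ⟨S', N', e', hN, hS, he, hinj, hadj, hbound⟩ := exists_placement G s e p.S (max p.N B)
    inj adj (fun a ha b hb => (hB _ (Finset.mem_image_of_mem _ ha) _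
        (Finset.mem_image_of_mem _ hb)).trans (le_max_right _ _)) Finset.univ
  rw [Finset.union_eq_right.2 (Finset.subset_univ s)] at hinj hadj hbound
  simp only [Finset.coe_univ, Set.injOn_univ, Finset.mem_univ,
    true_implies] at hinj hadj hbound
  have key : ∀ γ a, Perm.viaEmbeddingHom ⟨e', hinj⟩ (σ γ) (e' a) = e' (σ γ a) := fun γ a =>
    Perm.viaEmbedding_apply (σ γ) ⟨e', hinj⟩ a
  refine ⟨⟨N', S', Finset.univ.image e', (Perm.viaEmbeddingHom ⟨e', hinj⟩).comp σ, ?_, ?_, ?_⟩,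
    ⟨(le_max_left _ _).trans hN, fun d hd => hS d (hd.trans (le_max_left _ _)), ?_, ?_⟩, e', he,
    fun a => Finset.mem_image_of_mem _ (Finset.mem_univ a), key⟩
  · simp only [Finset.mem_image, Finset.mem_univ, true_and, forall_exists_index,
      forall_apply_eq_imp_iff]
    exact fun γ a => ⟨σ γ a, (key γ a).symm⟩
  · simp only [Finset.mem_image, Finset.mem_univ, true_and, forall_exists_index,
      forall_apply_eq_imp_iff]
    exact hbound
  · simp only [Finset.mem_image, Finset.mem_univ, true_and, forall_exists_index,
      forall_apply_eq_imp_iff]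
    intro γ a b
    rw [MonoidHom.comp_apply, key, key, hadj, hadj, hσ]
  · intro x hx
    obtain ⟨a, ha, rfl, -⟩ := hX x hx
    exact Finset.mem_image.2 ⟨a, Finset.mem_univ a, he a ha⟩
  · intro γ x hx
    obtain ⟨a, ha, rfl, h⟩ := hX x hx
    rw [← (h γ).2, ← he _ ha, ← he _ (h γ).1]
    exact key γ a

end GraphActionApprox

namespace GraphActionApprox

variable {Γ : Type*} [Group Γ]

/-- The action of `Γ` on the finite set of an approximation. -/
def permHom (p : GraphActionApprox Γ) : Γ →* Perm p.X where
  toFun γ := (p.ρ γ).subtypePerm fun x => ⟨fun h => by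
    simpa using p.map_mem γ⁻¹ _ h, p.map_mem γ x⟩
  map_one' := by ext; simp
  map_mul' γ δ := by ext x; exact congrArg (· (x : ℤ)) (map_mul p.ρ γ δ)

@[simp]
theorem coe_permHom_apply (p : GraphActionApprox Γ) (γ : Γ) (x : p.X) :
    (p.permHom γ x : ℤ) = p.ρ γ x := rfl

theorem adj_permHom (p : GraphActionApprox Γ) (γ : Γ) (x y : p.X) :
    (differenceGraph p.S).Adj (p.permHom γ x) (p.permHom γ y) ↔
      (differenceGraph p.S).Adj x y :=
  p.adj γ x x.2 y y.2

/-- The graph obtained from the finite set of an approximation by adding all the images of a new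
vertex `z` that the permutations of this set allow. -/
def orbitGraph (p : GraphActionApprox Γ) (z : ℤ) : SimpleGraph (p.X ⊕ Perm p.X) where
  Adj
    | .inl x, .inl y => (differenceGraph p.S).Adj x y
    | .inl x, .inr π => (differenceGraph p.S).Adj z (π⁻¹ x : p.X)
    | .inr π, .inl x => (differenceGraph p.S).Adj z (π⁻¹ x : p.X)
    | .inr _, .inr _ => False
  symm := ⟨by
    rintro (x | x) (y | y) h
    exacts [h.symm, h, h, h]⟩
  loopless := ⟨by
    rintro (x | x) h
    exacts [(differenceGraph p.S).loopless.irrefl _ h, h]⟩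

/-- The orbit of `z` is modelled on `Perm p.X`, on which `Γ` acts by left multiplication through
`permHom`. This is finite even when `Γ` is not. The identity is placed at `z` and the other
permutations wherever there is room. -/
theorem exists_le_mem (p : GraphActionApprox Γ) (z : ℤ) : ∃ q, p ≤ q ∧ z ∈ q.X := by
  classical
  by_cases hz : z ∈ p.X
  · exact ⟨p, le_rfl, hz⟩
  let σ : Γ →* Perm (p.X ⊕ Perm p.X) := (Perm.sumCongrHom _ _).comp
    (p.permHom.prod ((MulAction.toPermHom (Perm p.X) (Perm p.X)).comp p.permHom))
  have hσl : ∀ γ x, σ γ (.inl x) = .inl (p.permHom γ x) := fun _ _ => rfl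
  have hσr : ∀ γ π, σ γ (.inr π) = .inr (p.permHom γ * π) := fun _ _ => rfl
  have hadj : ∀ x π, (p.orbitGraph z).Adj (.inl x) (.inr π) ↔
      (differenceGraph p.S).Adj z (π⁻¹ x : p.X) := fun _ _ => Iff.rfl
  have hinv : ∀ γ π x, (p.permHom γ * π)⁻¹ (p.permHom γ x) = π⁻¹ x := fun γ π x => by
    rw [mul_inv_rev]
    exact congrArg _ ((p.permHom γ).symm_apply_apply x)
  have key := p.exists_le_of_finite (p.orbitGraph z) σ ?_
    (insert (.inr 1) (Finset.univ.image .inl)) (Sum.elim (fun x => x) fun _ => z) ?_ ?_ ?_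
  · obtain ⟨q, hpq, e', he', hmem, -⟩ := key
    have := hmem (.inr 1)
    rw [he' _ (Finset.mem_insert_self _ _)] at this
    exact ⟨q, hpq, this⟩
  · rintro γ (x | x) (y | y)
    · exact p.adj_permHom γ x y
    · rw [hσl, hσr, hadj, hadj, hinv]
    · rw [hσl, hσr, SimpleGraph.adj_comm (p.orbitGraph z), hadj, hinv,
        SimpleGraph.adj_comm (p.orbitGraph z), hadj]
    · exact Iff.rfl
  · rintro (x | x) hx (y | y) hy hxy <;> simp at hx hy hxy
    · exact congrArg _ hxy
    · exact absurd (hxy ▸ x.2) hz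
    · exact absurd (hxy ▸ y.2) hz
    · rw [hx, hy]
  · rintro (x | x) hx (y | y) hy <;> simp at hx hy
    · exact Iff.rfl
    · rw [hy, hadj, inv_one]
      exact SimpleGraph.adj_comm _ _ _
    · rw [hx, SimpleGraph.adj_comm (p.orbitGraph z), hadj, inv_one]
      rfl
    · simp [hx, hy, orbitGraph]
  · intro x hx
    exact ⟨.inl ⟨x, hx⟩, by simp, rfl, fun γ => ⟨by simp [hσl], by simp [hσl]⟩⟩

theorem exists_le_adj_iff (p : GraphActionApprox Γ) (E : Finset ℤ) (P : ℤ → Prop) :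
    ∃ q, p ≤ q ∧ ∃ z ∉ E, ∀ x ∈ E, (z - x).natAbs ≤ q.N ∧
      ((differenceGraph q.S).Adj z x ↔ P x) := by
  obtain ⟨S, z, hS, hz, h⟩ := exists_differenceGraph_adj_iff p.S p.N E P
  obtain ⟨B, hB⟩ := exists_natAbs_sub_le (insert z E)
  exact ⟨p.changeDistances (max p.N B) S (le_max_left _ _) hS, p.le_changeDistances _ _ _ _, z, hz,
    fun x hx => ⟨(hB z (Finset.mem_insert_self _ _) x (Finset.mem_insert_of_mem hx)).trans
      (le_max_right _ _), h x hx⟩⟩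

/-- A finite graph with an action of `Γ` can be added, a prescribed part of it being placed as a
translate of a given finite set. -/
theorem exists_le_translate (p : GraphActionApprox Γ) {Z : Type*} [Finite Z] (G : SimpleGraph Z)
    (σ : Γ →* Perm Z) (hσ : ∀ γ a b, G.Adj (σ γ a) (σ γ b) ↔ G.Adj a b) (F : Finset ℤ)
    (e : ℤ → Z) (inj : Set.InjOn e F)
    (adj : ∀ x ∈ F, ∀ y ∈ F, (differenceGraph p.S).Adj x y ↔ G.Adj (e x) (e y))
    (hN : ∀ x ∈ F, ∀ y ∈ F, (x - y).natAbs ≤ p.N) :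
    ∃ q, p ≤ q ∧ ∃ k : ℤ, (∀ x ∈ F, x + k ∈ q.X) ∧
      ∀ γ, ∀ x ∈ F, ∀ y ∈ F, σ γ (e x) = e y → q.ρ γ (x + k) = y + k := by
  classical
  -- Discarding all distances above `p.N` makes far apart vertices nonadjacent, so the old part and
  -- the translate of `F` form a disjoint sum of graphs.
  have hS : ∀ d ≤ p.N, d ∈ {d | d ≤ p.N ∧ d ∈ p.S} ↔ d ∈ p.S := fun d hd => by simp [hd]
  let p' := p.changeDistances p.N {d | d ≤ p.N ∧ d ∈ p.S} le_rfl hS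
  obtain ⟨B, hB⟩ : ∃ B : ℕ, ∀ x ∈ p.X ∪ F, x.natAbs ≤ B :=
    ⟨(p.X ∪ F).sup Int.natAbs, fun x hx => Finset.le_sup hx⟩
  -- Both sets lie in `[-B, B]`, so this shift leaves a gap larger than `p.N` between them.
  let k : ℤ := p.N + 2 * B + 1
  have hk : ∀ x ∈ p.X, ∀ y ∈ F, x ≠ y + k ∧ ¬ (differenceGraph p'.S).Adj x (y + k) := by
    intro x hx y hy
    have h1 := hB x (Finset.mem_union_left _ hx)
    have h2 := hB y (Finset.mem_union_right _ hy)
    refine ⟨by omega, fun h => ?_⟩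
    have h3 : (x - (y + k)).natAbs ≤ p.N := h.2.1
    omega
  let σ' : Γ →* Perm (p.X ⊕ Z) := (Perm.sumCongrHom _ _).comp (p.permHom.prod σ)
  have hσl : ∀ γ x, σ' γ (.inl x) = .inl (p.permHom γ x) := fun _ _ => rfl
  have hσr : ∀ γ a, σ' γ (.inr a) = .inr (σ γ a) := fun _ _ => rfl
  let j : p.X ⊕ Z → ℤ := Sum.elim (fun x => x) fun a => Function.invFunOn e F a + k
  have hj : ∀ x ∈ F, j (.inr (e x)) = x + k := fun x hx => by
    simp only [j, Sum.elim_inr, inj.leftInvOn_invFunOn hx]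
  have key := p'.exists_le_of_finite
    (((differenceGraph p.S).comap fun x : p.X => (x : ℤ)) ⊕g G) σ' ?_
    (Finset.univ.image .inl ∪ F.image fun x => .inr (e x)) j ?_ ?_ ?_
  · obtain ⟨q, hpq, e', he', hmem, heq⟩ := key
    have he'' : ∀ x ∈ F, e' (.inr (e x)) = x + k := fun x hx => by
      rw [he' _ (Finset.mem_union_right _ (Finset.mem_image_of_mem _ hx)), hj x hx]
    refine ⟨q, (p.le_changeDistances _ _ _ _).trans hpq, k, fun x hx => ?_, ?_⟩
    · exact he'' x hx ▸ hmem _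
    · intro γ x hx y hy h
      rw [← he'' x hx, heq, hσr, h, he'' y hy]
  · rintro γ (x | x) (y | y)
    · exact p.adj_permHom γ x y
    · simp [hσl, hσr]
    · simp [hσl, hσr]
    · simpa [hσr] using hσ γ x y
  · have hdisj : ∀ (x : p.X), ∀ y ∈ F, j (.inl x) ≠ j (.inr (e y)) := fun x y hy => by
      rw [hj y hy]
      exact (hk x x.2 y hy).1
    intro a ha b hb hab
    simp only [Finset.coe_union, Finset.coe_image, Set.mem_union, Set.mem_image, Finset.coe_univ,
      Set.mem_univ, true_and, Finset.mem_coe] at ha hb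
    obtain ⟨x, rfl⟩ | ⟨x, hx, rfl⟩ := ha <;> obtain ⟨y, rfl⟩ | ⟨y, hy, rfl⟩ := hb
    · exact congrArg _ (Subtype.ext hab)
    · exact absurd hab (hdisj x y hy)
    · exact absurd hab.symm (hdisj y x hx)
    · rw [hj x hx, hj y hy, add_left_inj] at hab
      rw [hab]
  · intro a ha b hb
    simp only [Finset.mem_union, Finset.mem_image, Finset.mem_univ, true_and] at ha hb
    obtain ⟨x, rfl⟩ | ⟨x, hx, rfl⟩ := ha <;> obtain ⟨y, rfl⟩ | ⟨y, hy, rfl⟩ := hb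
    · exact differenceGraph_adj_congr hS (p.bound x x.2 y y.2)
    · rw [hj y hy]
      exact iff_of_false (hk x x.2 y hy).2 (by simp)
    · rw [hj x hx, SimpleGraph.adj_comm]
      exact iff_of_false (hk y y.2 x hx).2 (by simp)
    · rw [hj x hx, hj y hy, differenceGraph_adj_add_right,
        differenceGraph_adj_congr (S' := p'.S) hS (hN x hx y hy), adj x hx y hy]
      simp
  · intro x hx
    refine ⟨.inl ⟨x, hx⟩, by simp, rfl, fun γ => ⟨by simp [hσl], rfl⟩⟩

end GraphActionApprox

/-! ### The generic action -/

theorem exists_monotone_meeting_cofinal {P ι : Type*} [Preorder P] [Nonempty P] [Countable ι]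
    (D : ι → Set P) (hD : ∀ i p, ∃ q, p ≤ q ∧ q ∈ D i) :
    ∃ u : ℕ → P, Monotone u ∧ ∀ i, ∃ n, u n ∈ D i := by
  have := Encodable.ofCountable ι
  let 𝒟 : ι → Order.Cofinal P := fun i =>
    ⟨D i, fun p => let ⟨q, h, h'⟩ := hD i p; ⟨q, h', h⟩⟩
  exact ⟨_, Order.sequenceOfCofinals.monotone (Classical.arbitrary P) 𝒟, fun i =>
    ⟨_, Order.sequenceOfCofinals.encode_mem (Classical.arbitrary P) 𝒟 i⟩⟩

/-- The finite set `F` of vertices of `G`, together with the partial maps given by the triples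
`(γ, x, y)` in `h`, embeds in a finite graph with an action of `Γ`. -/
def IsFinitelyRealizable {Γ V : Type*} [Group Γ] (G : SimpleGraph V) (F : Finset V)
    (h : Set (Γ × V × V)) : Prop :=
  ∃ (n : ℕ) (H : SimpleGraph (Fin n)) (σ : Γ →* Perm (Fin n)) (e : V → Fin n),
    (∀ γ a b, H.Adj (σ γ a) (σ γ b) ↔ H.Adj a b) ∧ Set.InjOn e F ∧
    (∀ x ∈ F, ∀ y ∈ F, G.Adj x y ↔ H.Adj (e x) (e y)) ∧ ∀ t ∈ h, σ t.1 (e t.2.1) = e t.2.2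

theorem IsFinitelyRealizable.of_finite {Γ V Y : Type*} [Group Γ] [Finite Y] {G : SimpleGraph V}
    {F : Finset V} {h : Set (Γ × V × V)} (H : SimpleGraph Y) (σ : Γ →* Perm Y) (e : V → Y)
    (hσ : ∀ γ a b, H.Adj (σ γ a) (σ γ b) ↔ H.Adj a b) (inj : Set.InjOn e F)
    (adj : ∀ x ∈ F, ∀ y ∈ F, G.Adj x y ↔ H.Adj (e x) (e y))
    (hh : ∀ t ∈ h, σ t.1 (e t.2.1) = e t.2.2) : IsFinitelyRealizable G F h := by
  obtain ⟨n, ⟨φ⟩⟩ := Finite.exists_equiv_fin Y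
  refine ⟨n, H.comap φ.symm, φ.permCongrHom.toMonoidHom.comp σ, φ ∘ e, ?_, ?_, ?_, ?_⟩
  · intro γ a b
    simpa using hσ γ (φ.symm a) (φ.symm b)
  · exact φ.injective.comp_injOn inj
  · intro x hx y hy
    simpa using adj x hx y hy
  · intro t ht
    simpa using hh t ht

namespace GraphActionApprox

variable {Γ : Type*} [Group Γ]

instance : Nonempty (GraphActionApprox Γ) :=
  ⟨⟨0, ∅, ∅, 1, by simp, by simp, by simp⟩⟩

/-- Whether a pattern is realizable depends on the graph still under construction. All distances
within `F` are decided first, in `p'`. This settles the question for every extension, and only then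
is the pattern added, if possible. -/
theorem exists_le_of_isFinitelyRealizable (p : GraphActionApprox Γ) (F : Finset ℤ)
    (h : Finset (Γ × ℤ × ℤ)) (hh : ∀ t ∈ h, t.2.1 ∈ F ∧ t.2.2 ∈ F) :
    ∃ q, p ≤ q ∧ ∃ p' ≤ q, (∀ x ∈ F, ∀ y ∈ F, (x - y).natAbs ≤ p'.N) ∧
      (IsFinitelyRealizable (differenceGraph p'.S) F (h : Set (Γ × ℤ × ℤ)) →
        ∃ k : ℤ, ∀ t ∈ h, t.2.1 + k ∈ q.X ∧ q.ρ t.1 (t.2.1 + k) = t.2.2 + k) := by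
  obtain ⟨B, hB⟩ := exists_natAbs_sub_le F
  let p' := p.changeDistances (max p.N B) p.S (le_max_left _ _) fun _ _ => Iff.rfl
  have hpp' : p ≤ p' := p.le_changeDistances _ _ _ _
  have hN : ∀ x ∈ F, ∀ y ∈ F, (x - y).natAbs ≤ p'.N := fun x hx y hy =>
    (hB x hx y hy).trans (le_max_right _ _)
  by_cases hreal : IsFinitelyRealizable (differenceGraph p'.S) F (h : Set (Γ × ℤ × ℤ))
  · obtain ⟨n, H, σ, e, hσ, inj, adj, he⟩ := hreal
    obtain ⟨q, hq, k, hk, hk'⟩ := p'.exists_le_translate H σ hσ F e inj adj hN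
    exact ⟨q, hpp'.trans hq, p', hq, hN, fun _ => ⟨k, fun t ht => ⟨hk _ (hh t ht).1,
      hk' _ _ (hh t ht).1 _ (hh t ht).2 (he t ht)⟩⟩⟩
  · exact ⟨p', hpp', p', le_rfl, hN, fun h => absurd h hreal⟩

/-- The limit of an increasing sequence of approximations exhausting the integers. -/
theorem exists_limit (u : ℕ → GraphActionApprox Γ) (hu : Monotone u)
    (hX : ∀ x, ∃ n, x ∈ (u n).X) :
    ∃ (S : Set ℕ) (π : Γ →* (differenceGraph S ≃g differenceGraph S)),
      (∀ n, ∀ d ≤ (u n).N, d ∈ S ↔ d ∈ (u n).S) ∧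
      ∀ n, ∀ x ∈ (u n).X, ∀ γ, π γ x = (u n).ρ γ x := by
  let S : Set ℕ := {d | ∃ n, d ≤ (u n).N ∧ d ∈ (u n).S}
  have hS : ∀ n, ∀ d ≤ (u n).N, d ∈ S ↔ d ∈ (u n).S := by
    refine fun n d hd => ⟨fun ⟨m, hm, hm'⟩ => ?_, fun h => ⟨n, hd, h⟩⟩
    rcases le_total n m with h | h
    · exact ((hu h).2.1 d hd).1 hm'
    · exact ((hu h).2.1 d hm).2 hm'
  choose i hi using hX
  let f : Γ → ℤ → ℤ := fun γ x => (u (i x)).ρ γ x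
  have hf : ∀ n, ∀ x ∈ (u n).X, ∀ γ, f γ x = (u n).ρ γ x := by
    intro n x hx γ
    rcases le_total n (i x) with h | h
    · exact (hu h).2.2.2 γ x hx
    · exact ((hu h).2.2.2 γ x (hi x)).symm
  have hmul : ∀ γ δ x, f (γ * δ) x = f γ (f δ x) := by
    intro γ δ x
    rw [hf (i x) (f δ x) ((u (i x)).map_mem δ x (hi x))]
    simp [f]
  have hone : ∀ x, f 1 x = x := fun x => by simp [f]
  have hadj : ∀ γ x y, (differenceGraph S).Adj (f γ x) (f γ y) ↔ (differenceGraph S).Adj x y := by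
    intro γ x y
    obtain ⟨n, hx, hy⟩ : ∃ n, x ∈ (u n).X ∧ y ∈ (u n).X :=
      ⟨max (i x) (i y), (hu (le_max_left _ _)).2.2.1 (hi x), (hu (le_max_right _ _)).2.2.1 (hi y)⟩
    rw [hf n x hx, hf n y hy, differenceGraph_adj_congr (hS n) ((u n).bound x hx y hy),
      differenceGraph_adj_congr (hS n)
        ((u n).bound _ ((u n).map_mem γ x hx) _ ((u n).map_mem γ y hy)), (u n).adj γ x hx y hy]
  refine ⟨S, MonoidHom.mk' (fun γ => ⟨⟨f γ, f γ⁻¹, fun x => ?_, fun x => ?_⟩, hadj γ _ _⟩)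
    fun γ δ => ?_, hS, hf⟩
  · rw [← hmul, inv_mul_cancel, hone]
  · rw [← hmul, mul_inv_cancel, hone]
  · ext x
    exact hmul γ δ x

/-- There are a difference graph with the extension property of the random graph and an action of
`Γ` on it such that every finitely realizable pattern occurs in a translate of the action. -/
theorem exists_differenceGraph_action [Countable Γ] :
    ∃ (S : Set ℕ) (π : Γ →* (differenceGraph S ≃g differenceGraph S)),
      (∀ E A : Finset ℤ, ∃ z ∉ E, ∀ x ∈ E, (differenceGraph S).Adj z x ↔ x ∈ A) ∧
      ∀ (F : Finset ℤ) (h : Finset (Γ × ℤ × ℤ)), (∀ t ∈ h, t.2.1 ∈ F ∧ t.2.2 ∈ F) →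
        IsFinitelyRealizable (differenceGraph S) F (h : Set (Γ × ℤ × ℤ)) →
        ∃ k : ℤ, ∀ t ∈ h, π t.1 (t.2.1 + k) = t.2.2 + k := by
  -- The three families of requirements: every integer enters the domain, the extension property
  -- holds, and every realizable pattern occurs.
  obtain ⟨u, hu, hD⟩ := exists_monotone_meeting_cofinal
    (Sum.elim (fun z : ℤ => {q : GraphActionApprox Γ | z ∈ q.X}) <| Sum.elim
      (fun EA : Finset ℤ × Finset ℤ => {q : GraphActionApprox Γ | ∃ z ∉ EA.1, ∀ x ∈ EA.1,
        (z - x).natAbs ≤ q.N ∧ ((differenceGraph q.S).Adj z x ↔ x ∈ EA.2)})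
      fun Fh : {Fh : Finset ℤ × Finset (Γ × ℤ × ℤ) // ∀ t ∈ Fh.2, t.2.1 ∈ Fh.1 ∧ t.2.2 ∈ Fh.1} =>
        {q : GraphActionApprox Γ | ∃ p' ≤ q, (∀ x ∈ Fh.1.1, ∀ y ∈ Fh.1.1, (x - y).natAbs ≤ p'.N) ∧
          (IsFinitelyRealizable (differenceGraph p'.S) Fh.1.1 (Fh.1.2 : Set (Γ × ℤ × ℤ)) →
            ∃ k : ℤ, ∀ t ∈ Fh.1.2, t.2.1 + k ∈ q.X ∧ q.ρ t.1 (t.2.1 + k) = t.2.2 + k)}) (by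
    rintro (z | EA | Fh) p
    · exact p.exists_le_mem z
    · exact p.exists_le_adj_iff EA.1 (· ∈ EA.2)
    · exact p.exists_le_of_isFinitelyRealizable Fh.1.1 Fh.1.2 Fh.2)
  obtain ⟨S, π, hS, hπ⟩ := exists_limit u hu fun x => hD (.inl x)
  refine ⟨S, π, fun E A => ?_, fun F h hh hreal => ?_⟩
  · obtain ⟨n, z, hz, h⟩ := hD (.inr (.inl (E, A)))
    exact ⟨z, hz, fun x hx => (differenceGraph_adj_congr (hS n) (h x hx).1).trans (h x hx).2⟩
  · obtain ⟨n, p', hp', hN, hk⟩ := hD (.inr (.inr ⟨(F, h), hh⟩))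
    have hS' : ∀ d ≤ p'.N, d ∈ S ↔ d ∈ p'.S := fun d hd =>
      (hS n d (hd.trans hp'.1)).trans (hp'.2.1 d hd)
    obtain ⟨m, H, σ, e, hσ, inj, adj, he⟩ := hreal
    obtain ⟨k, hk⟩ := hk ⟨m, H, σ, e, hσ, inj, fun x hx y hy => by
      rw [← adj x hx y hy, differenceGraph_adj_congr hS' (hN x hx y hy)], he⟩
    exact ⟨k, fun t ht => (hπ n _ (hk t ht).1 t.1).trans (hk t ht).2⟩

end GraphActionApprox

/-! ### Finite realizability for abelian groups -/

theorem CommGroup.residuallyFinite_of_fg (Γ : Type*) [CommGroup Γ] [Group.FG Γ] :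
    Group.ResiduallyFinite Γ := by
  obtain ⟨ι, j, _, _, p, hp, e, ⟨f⟩⟩ := CommGroup.equiv_free_prod_prod_multiplicative_zmod Γ
  refine Group.residuallyFinite_of_forall_exists_finite_monoidHom (G := Γ) fun g hg => ?_
  have hfg : f g ≠ 1 := fun h => hg (by simpa using h)
  by_cases h1 : (f g).1 = 1
  · obtain ⟨i, hi⟩ : ∃ i, (f g).2 i ≠ 1 := by
      by_contra! h
      exact hfg (Prod.ext h1 (funext h))
    have : NeZero (p i ^ e i) := ⟨pow_ne_zero _ (hp i).ne_zero⟩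
    exact ⟨Multiplicative (ZMod (p i ^ e i)), inferInstance, inferInstance,
      (Pi.evalMonoidHom _ i).comp ((MonoidHom.snd _ _).comp f.toMonoidHom), hi⟩
  · obtain ⟨i, hi⟩ : ∃ i, (f g).1 i ≠ 1 := by
      by_contra! h
      exact h1 (funext h)
    let z : ℤ := Multiplicative.toAdd ((f g).1 i)
    have hz : z ≠ 0 := fun h => hi h
    -- A nonzero `z` survives modulo `|z| + 1`.
    refine ⟨Multiplicative (ZMod (z.natAbs + 1)), inferInstance, inferInstance,
      (AddMonoidHom.toMultiplicative (Int.castAddHom (ZMod (z.natAbs + 1)))).comp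
        ((Pi.evalMonoidHom _ i).comp ((MonoidHom.fst _ _).comp f.toMonoidHom)), fun h => hz ?_⟩
    have h' : ((z : ℤ) : ZMod (z.natAbs + 1)) = 0 := h
    rw [ZMod.intCast_zmod_eq_zero_iff_dvd] at h'
    exact Int.eq_zero_of_abs_lt_dvd h' (by push_cast; rw [Int.abs_eq_natAbs]; omega)

/-- Subgroups of finitely generated abelian groups are closed in the profinite topology. -/
theorem CommGroup.exists_finiteIndex_le_notMem {Γ : Type*} [CommGroup Γ] [Group.FG Γ]
    (H : Subgroup Γ) {g : Γ} (hg : g ∉ H) :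
    ∃ N : Subgroup Γ, N.FiniteIndex ∧ H ≤ N ∧ g ∉ N := by
  have := CommGroup.residuallyFinite_of_fg (Γ ⧸ H)
  obtain ⟨K, hK, hgK⟩ := Group.residuallyFinite_iff_exists_finiteIndex.1 this (g : Γ ⧸ H)
    (by rwa [Ne, QuotientGroup.eq_one_iff])
  refine ⟨K.comap (QuotientGroup.mk' H), ⟨by
    rw [K.index_comap_of_surjective (QuotientGroup.mk'_surjective H)]
    exact hK.index_ne_zero⟩, fun h hh => ?_, hgK⟩
  rw [Subgroup.mem_comap, QuotientGroup.mk'_apply, (QuotientGroup.eq_one_iff h).2 hh]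
  exact K.one_mem

section Abelian

variable {Γ V : Type*} [CommGroup Γ] [Group.FG Γ] [MulAction Γ V]

/-- The elements moving `x` to `a` and those moving `y` to `b` form cosets `α Stab x` and `β Stab
y`, if nonempty. They are disjoint iff `α⁻¹ * β` lies outside `Stab x · Stab y`. By commutativity
this product is a subgroup, so a finite-index `N` containing it excludes `α⁻¹ * β`. -/
theorem exists_finiteIndex_forall_exists_smul_eq (x a y b : V) :
    ∃ N : Subgroup Γ, N.FiniteIndex ∧ ∀ γ δ : Γ, γ • x = a → δ • y = b → γ⁻¹ * δ ∈ N →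
      ∃ ε : Γ, ε • x = a ∧ ε • y = b := by
  by_cases h : ∃ ε : Γ, ε • x = a ∧ ε • y = b
  · exact ⟨⊤, inferInstance, fun _ _ _ _ _ => h⟩
  by_cases hα : ∃ α : Γ, α • x = a
  swap
  · exact ⟨⊤, inferInstance, fun γ _ hγ => absurd ⟨γ, hγ⟩ hα⟩
  by_cases hβ : ∃ β : Γ, β • y = b
  swap
  · exact ⟨⊤, inferInstance, fun _ δ _ hδ => absurd ⟨δ, hδ⟩ hβ⟩
  obtain ⟨α, hα⟩ := hα
  obtain ⟨β, hβ⟩ := hβ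
  obtain ⟨N, hN, hle, hmem⟩ := CommGroup.exists_finiteIndex_le_notMem
    (MulAction.stabilizer Γ x ⊔ MulAction.stabilizer Γ y) (g := α⁻¹ * β) fun hm => by
      obtain ⟨s, hs, t, ht, hst⟩ := Subgroup.mem_sup.1 hm
      rw [MulAction.mem_stabilizer_iff] at hs ht
      refine h ⟨α * s, by rw [mul_smul, hs, hα], ?_⟩
      have : α * s = β * t⁻¹ := by rw [eq_mul_inv_iff_mul_eq, mul_assoc, hst, mul_inv_cancel_left]
      rw [this, mul_smul, inv_smul_eq_iff.2 ht.symm, hβ]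
  refine ⟨N, hN, fun γ δ hγ hδ hγδ => absurd ?_ hmem⟩
  have h1 : α⁻¹ * γ ∈ N := hle <| Subgroup.mem_sup_left <| by
    rw [MulAction.mem_stabilizer_iff, mul_smul, hγ, inv_smul_eq_iff, hα]
  have h2 : β⁻¹ * δ ∈ N := hle <| Subgroup.mem_sup_right <| by
    rw [MulAction.mem_stabilizer_iff, mul_smul, hδ, inv_smul_eq_iff, hβ]
  convert N.mul_mem (N.mul_mem h1 hγδ) (N.inv_mem h2) using 1
  group

open scoped Pointwise

/-- A vertex `x` is recorded by the cosets of `N` that contain an element moving `a` to `x`, for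
each `a ∈ F`. This map is equivariant on all of `V` and has a finite target. The edges are the
translates of those within `F`. The choice of `N` makes the map injective on `F` and excludes
spurious edges there. -/
theorem isFinitelyRealizable_of_mulAction (G : SimpleGraph V)
    (hG : ∀ (γ : Γ) x y, G.Adj (γ • x) (γ • y) ↔ G.Adj x y) (F : Finset V) :
    IsFinitelyRealizable G F {t : Γ × V × V | t.1 • t.2.1 = t.2.2} := by
  choose M hM hMsep using exists_finiteIndex_forall_exists_smul_eq (Γ := Γ) (V := V)
  let N : Subgroup Γ := ⨅ i : F × F × F × F, M i.1 i.2.1 i.2.2.1 i.2.2.2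
  have hN : N.FiniteIndex := Subgroup.finiteIndex_iInf fun _ => hM _ _ _ _
  have hsep : ∀ x ∈ F, ∀ a ∈ F, ∀ y ∈ F, ∀ b ∈ F, ∀ γ δ : Γ, γ • x = a → δ • y = b →
      γ⁻¹ * δ ∈ N → ∃ ε : Γ, ε • x = a ∧ ε • y = b :=
    fun x hx a ha y hy b hb γ δ hγ hδ h => hMsep x a y b γ δ hγ hδ <|
      Subgroup.mem_iInf.1 h (⟨x, hx⟩, ⟨a, ha⟩, ⟨y, hy⟩, ⟨b, hb⟩)
  let e : V → F → Set (Γ ⧸ N) := fun x a => {c | ∃ γ : Γ, (γ : Γ ⧸ N) = c ∧ γ • (a : V) = x}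
  have he : ∀ (γ : Γ) x, γ • e x = e (γ • x) := by
    intro γ x
    ext a c
    rw [Pi.smul_apply, Set.mem_smul_set_iff_inv_smul_mem]
    constructor
    · rintro ⟨δ, hδ, h⟩
      refine ⟨γ * δ, ?_, by rw [mul_smul, h]⟩
      rw [← smul_eq_mul, ← MulAction.Quotient.smul_coe, hδ, smul_inv_smul]
    · rintro ⟨δ, hδ, h⟩
      refine ⟨γ⁻¹ * δ, ?_, by rw [mul_smul, h, inv_smul_smul]⟩
      rw [← smul_eq_mul, ← MulAction.Quotient.smul_coe, hδ]
  have hself : ∀ x ∈ F, ∀ y, e x = e y → ∃ γ : Γ, (γ : Γ ⧸ N) = (1 : Γ) ∧ γ • x = y := by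
    intro x hx y h
    have : ((1 : Γ) : Γ ⧸ N) ∈ e x ⟨x, hx⟩ := ⟨1, rfl, one_smul _ _⟩
    rwa [h] at this
  have inj : Set.InjOn e F := by
    intro x hx y hy hxy
    obtain ⟨γ, hγ, h⟩ := hself x hx y hxy
    obtain ⟨ε, h1, h2⟩ := hsep x hx y hy x hx x hx γ 1 h (one_smul _ _) (QuotientGroup.eq.1 hγ)
    exact h2.symm.trans h1
  let H : SimpleGraph (F → Set (Γ ⧸ N)) :=
    { Adj A B := A ≠ B ∧ ∃ γ : Γ, ∃ a ∈ F, ∃ b ∈ F, G.Adj a b ∧ A = γ • e a ∧ B = γ • e b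
      symm := ⟨fun A B ⟨h, γ, a, ha, b, hb, hab, h1, h2⟩ =>
        ⟨h.symm, γ, b, hb, a, ha, hab.symm, h2, h1⟩⟩
      loopless := ⟨fun _ h => h.1 rfl⟩ }
  refine .of_finite H (MulAction.toPermHom Γ _) e ?_ inj ?_ fun t ht =>
    (he t.1 t.2.1).trans (congrArg e ht)
  · intro δ A B
    change H.Adj (δ • A) (δ • B) ↔ H.Adj A B
    refine and_congr (MulAction.injective δ).ne_iff ⟨?_, ?_⟩
    · rintro ⟨γ, a, ha, b, hb, hab, h1, h2⟩
      exact ⟨δ⁻¹ * γ, a, ha, b, hb, hab, by rw [mul_smul, ← h1, inv_smul_smul],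
        by rw [mul_smul, ← h2, inv_smul_smul]⟩
    · rintro ⟨γ, a, ha, b, hb, hab, rfl, rfl⟩
      exact ⟨δ * γ, a, ha, b, hb, hab, (mul_smul _ _ _).symm, (mul_smul _ _ _).symm⟩
  · intro x hx y hy
    constructor
    · exact fun h => ⟨fun h' => h.ne (inj hx hy h'), 1, x, hx, y, hy, h, (one_smul _ _).symm,
        (one_smul _ _).symm⟩
    · rintro ⟨-, γ, a, ha, b, hb, hab, h1, h2⟩
      obtain ⟨n, hn, h1⟩ := hself x hx _ (h1.trans (he γ a))
      obtain ⟨m, hm, h2⟩ := hself y hy _ (h2.trans (he γ b))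
      -- The elements `γ⁻¹ * n` and `γ⁻¹ * m` move `x` to `a` and `y` to `b` and agree modulo `N`;
      -- hence a single `ε` does both, and it preserves adjacency in `G`.
      obtain ⟨ε, rfl, rfl⟩ := hsep x hx a ha y hy b hb (γ⁻¹ * n) (γ⁻¹ * m)
        (by rw [mul_smul, h1, inv_smul_smul]) (by rw [mul_smul, h2, inv_smul_smul]) (by
          rw [show (γ⁻¹ * n)⁻¹ * (γ⁻¹ * m) = n⁻¹ * m by group]
          exact QuotientGroup.eq.1 (hn.trans hm.symm))
      exact (hG ε x y).1 hab

end Abelian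

theorem isFinitelyRealizable_of_commGroup {Γ V : Type*} [CommGroup Γ]
    [Group.FG Γ] (G : SimpleGraph V) (π : Γ →* (G ≃g G)) (F : Finset V) :
    IsFinitelyRealizable G F {t : Γ × V × V | π t.1 t.2.1 = t.2.2} := by
  let _ : MulAction Γ V :=
    { smul γ x := π γ x
      one_smul x := by change π 1 x = x; simp
      mul_smul γ δ x := by change π (γ * δ) x = π γ (π δ x); simp }
  exact isFinitelyRealizable_of_mulAction G (fun γ x y => (π γ).map_adj_iff) F

/-! ### Finite realizability for free groups -/

/-- The graph of pairs of a vertex and a valuation of the vertices, two pairs being adjacent if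
their vertices are distinct and each other's values at them differ. It contains every graph on `α`
in such a way that partial automorphisms extend to automorphisms. -/
def valuationGraph (α : Type*) : SimpleGraph (α × (α → Bool)) where
  Adj p q := p.1 ≠ q.1 ∧ p.2 q.1 ≠ q.2 p.1
  symm := ⟨fun _ _ h => ⟨h.1.symm, h.2.symm⟩⟩
  loopless := ⟨fun _ h => h.1 rfl⟩

/-- The automorphism of the valuation graph given by a permutation of the vertices and a change of
valuations. -/
def valuationPerm {α : Type*} (p : Perm α) (k : α → α → Bool) : Perm (α × (α → Bool)) where
  toFun a := (p a.1, fun u => xor (a.2 (p.symm u)) (k a.1 (p.symm u)))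
  invFun a := (p.symm a.1, fun u => xor (a.2 (p u)) (k (p.symm a.1) u))
  left_inv a := by ext <;> simp
  right_inv a := by ext <;> simp

/-- The two bits compared by adjacency are flipped by `k a.1 b.1` and `k b.1 a.1`, which agree by
symmetry. -/
theorem valuationGraph_adj_valuationPerm {α : Type*} (p : Perm α) (k : α → α → Bool)
    (hk : ∀ u v, k u v = k v u) (a b : α × (α → Bool)) :
    (valuationGraph α).Adj (valuationPerm p k a) (valuationPerm p k b) ↔
      (valuationGraph α).Adj a b := by
  simp only [valuationGraph, valuationPerm, coe_fn_mk, symm_apply_apply, p.injective.ne_iff,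
    hk b.1 a.1, ne_eq, Bool.xor_left_inj]

open Classical in
/-- The embedding of a graph into the valuation graph. -/
noncomputable def valuationEmb {α : Type*} [LinearOrder α] (G : SimpleGraph α) (v : α) :
    α × (α → Bool) :=
  (v, fun u => decide (u < v ∧ G.Adj v u))

open Classical in
theorem valuationEmb_xor {α : Type*} [LinearOrder α] (G : SimpleGraph α) (v u : α) :
    xor ((valuationEmb G v).2 u) ((valuationEmb G u).2 v) = decide (G.Adj v u) := by
  rcases lt_trichotomy u v with h | rfl | h
  · simp [valuationEmb, h, h.not_gt]
  · simp [valuationEmb]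
  · simp [valuationEmb, h, h.not_gt, G.adj_comm]

theorem valuationGraph_adj_valuationEmb {α : Type*} [LinearOrder α] (G : SimpleGraph α) (v u : α) :
    (valuationGraph α).Adj (valuationEmb G v) (valuationEmb G u) ↔ G.Adj v u := by
  classical
  have h := valuationEmb_xor G v u
  have h' : xor ((valuationEmb G v).2 u) ((valuationEmb G u).2 v) = true ↔ G.Adj v u := by simp [h]
  rw [← h', bne_iff_ne]
  refine ⟨fun h => h.2, fun h => ⟨?_, h⟩⟩
  exact (h'.1 (bne_iff_ne.2 h)).ne

/-- **Extension property for partial automorphisms** of finite graphs. -/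
theorem exists_valuationPerm_valuationEmb {α : Type*} [Finite α] [LinearOrder α]
    (G : SimpleGraph α) (D : Set α) (f : α → α) (hf : Set.InjOn f D)
    (hG : ∀ u ∈ D, ∀ v ∈ D, G.Adj (f u) (f v) ↔ G.Adj u v) :
    ∃ θ : Perm (α × (α → Bool)),
      (∀ a b, (valuationGraph α).Adj (θ a) (θ b) ↔ (valuationGraph α).Adj a b) ∧
      ∀ v ∈ D, θ (valuationEmb G v) = valuationEmb G (f v) := by
  classical
  have := Fintype.ofFinite α
  let p : Perm α := (Equiv.Set.imageOfInjOn f D hf).extendSubtype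
  have hp : ∀ v ∈ D, p v = f v := fun v hv =>
    (Equiv.Set.imageOfInjOn f D hf).extendSubtype_apply_of_mem v hv
  -- The flip needed to carry the valuation of `v` to that of `p v`. It is symmetric on `D` because
  -- `f` preserves adjacency there.
  let d : α → α → Bool := fun v u => xor ((valuationEmb G (p v)).2 (p u)) ((valuationEmb G v).2 u)
  have hd : ∀ u ∈ D, ∀ v ∈ D, d u v = d v u := by
    intro u hu v hv
    have h1 := valuationEmb_xor G (p u) (p v)
    have h2 := valuationEmb_xor G u v
    rw [hp u hu, hp v hv] at h1
    simp only [hG u hu v hv, ← h2] at h1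
    simp only [d, hp u hu, hp v hv]
    revert h1
    generalize (valuationEmb G (f u)).2 (f v) = a
    generalize (valuationEmb G (f v)).2 (f u) = b
    generalize (valuationEmb G u).2 v = a'
    generalize (valuationEmb G v).2 u = b'
    revert a b a' b'
    decide
  -- Rows indexed by `D` are prescribed by `d`; the remaining entries are filled in by symmetry.
  let k : α → α → Bool := fun v u => if v ∈ D then d v u else if u ∈ D then d u v else false
  have hk : ∀ u v, k u v = k v u := by
    intro u v
    by_cases hu : u ∈ D <;> by_cases hv : v ∈ D <;> simp [k, hu, hv]
    exact hd u hu v hv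
  refine ⟨valuationPerm p k, valuationGraph_adj_valuationPerm p k hk, fun v hv => ?_⟩
  refine Prod.ext (hp v hv) (funext fun u => ?_)
  change xor ((valuationEmb G v).2 (p.symm u)) (k v (p.symm u)) = _
  simp only [k, if_pos hv, d, apply_symm_apply, hp v hv]
  rw [Bool.xor_comm, Bool.xor_assoc, Bool.xor_self, Bool.xor_false]

/-- Each generator induces a partial automorphism of the graph on `A`, which extends to the
valuation graph over `A`. By freeness, extensions chosen independently for the generators define an
action. -/
theorem FreeGroupBasis.exists_finite_action {ι Γ : Type*} {V : Type u} [Group Γ] (b : FreeGroupBasis ι Γ)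
    [LinearOrder V] (G : SimpleGraph V) (π : Γ →* (G ≃g G)) (A : Finset V) (hA : A.Nonempty) :
    ∃ (Y : Type u) (_ : Finite Y) (H : SimpleGraph Y) (σ : Γ →* Perm Y) (e : V → Y),
      (∀ γ a b, H.Adj (σ γ a) (σ γ b) ↔ H.Adj a b) ∧ Set.InjOn e A ∧
      (∀ x ∈ A, ∀ y ∈ A, G.Adj x y ↔ H.Adj (e x) (e y)) ∧
      ∀ i, ∀ x ∈ A, π (b i) x ∈ A → σ (b i) (e x) = e (π (b i) x) := by
  classical
  let G' : SimpleGraph A := G.comap (↑)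
  obtain ⟨x₀, hx₀⟩ := hA
  let r : V → A := fun x => if h : x ∈ A then ⟨x, h⟩ else ⟨x₀, hx₀⟩
  have hr : ∀ x, x ∈ A → (r x : V) = x := fun x hx => by simp [r, hx]
  have key : ∀ i, ∃ θ : valuationGraph A ≃g valuationGraph A, ∀ v : A, π (b i) v ∈ A →
      θ (valuationEmb G' v) = valuationEmb G' (r (π (b i) v)) := by
    intro i
    obtain ⟨θ, h, h'⟩ := exists_valuationPerm_valuationEmb G' {v : A | π (b i) v ∈ A}
      (fun v => r (π (b i) v)) (fun u hu v hv huv => by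
        have := congrArg Subtype.val huv
        rw [hr _ hu, hr _ hv] at this
        exact Subtype.ext ((π (b i)).injective this)) fun u hu v hv => by
        simp only [G', SimpleGraph.comap_adj]
        rw [hr _ hu, hr _ hv, (π (b i)).map_adj_iff]
    exact ⟨⟨θ, h _ _⟩, h'⟩
  choose θ hθ using key
  let σ' : Γ →* (valuationGraph A ≃g valuationGraph A) := b.lift θ
  let σ : Γ →* Perm (A × (A → Bool)) :=
    { toFun γ := (σ' γ).toEquiv
      map_one' := by rw [map_one]; rfl
      map_mul' γ δ := by rw [map_mul]; rfl }
  have hσ : ∀ i a, σ (b i) a = θ i a := fun i a => by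
    change b.lift θ (b i) a = _
    rw [show b.lift θ (b i) = θ i from congrFun (b.lift.symm_apply_apply θ) i]
  refine ⟨_, inferInstance, valuationGraph A, σ, fun x => valuationEmb G' (r x), ?_, ?_, ?_, ?_⟩
  · exact fun γ a b => (σ' γ).map_adj_iff
  · intro x hx y hy hxy
    have := congrArg (fun p => (p.1 : V)) hxy
    simpa [valuationEmb, hr x hx, hr y hy] using this
  · intro x hx y hy
    rw [valuationGraph_adj_valuationEmb, SimpleGraph.comap_adj, hr x hx, hr y hy]
  · intro i x hx h
    have := hθ i (r x)
    rw [hr x hx] at this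
    rw [hσ, this h]

/-- The values of a group element on a finite set are determined by the partial maps that the
generators induce on a larger finite set. -/
theorem FreeGroupBasis.exists_finset_equivariant {ι Γ : Type*} {V : Type u} [Group Γ]
    (b : FreeGroupBasis ι Γ) (π : Γ →* Perm V) (γ : Γ) (F : Finset V) :
    ∃ A : Finset V, ∀ {Y : Type u} (σ : Γ →* Perm Y) (e : V → Y),
      (∀ i, ∀ x ∈ A, π (b i) x ∈ A → σ (b i) (e x) = e (π (b i) x)) →
      ∀ x ∈ F, σ γ (e x) = e (π γ x) := by
  classical
  obtain ⟨w, rfl⟩ := b.repr.symm.surjective γ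
  induction w using FreeGroup.induction_on generalizing F with
  | C1 => exact ⟨∅, fun σ e _ x _ => by simp⟩
  | of i =>
    refine ⟨F ∪ F.image (π (b i)), fun σ e h x hx => ?_⟩
    exact h i x (Finset.mem_union_left _ hx) (Finset.mem_union_right _ (Finset.mem_image_of_mem _ hx))
  | inv_of i ih =>
    obtain ⟨A, hA⟩ := ih (F.image (π (b i)⁻¹))
    refine ⟨A, fun σ e h x hx => ?_⟩
    have := hA σ e h _ (Finset.mem_image_of_mem _ hx)
    change σ (b i) _ = e (π (b i) _) at this
    rw [← Perm.mul_apply, ← map_mul, mul_inv_cancel, map_one, Perm.one_apply] at this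
    rw [map_inv, map_inv, Perm.inv_eq_iff_eq, ← this]
    rfl
  | mul u v hu hv =>
    obtain ⟨A, hA⟩ := hv F
    obtain ⟨B, hB⟩ := hu (F.image (π (b.repr.symm v)))
    refine ⟨A ∪ B, fun σ e h x hx => ?_⟩
    rw [map_mul, map_mul, map_mul, Perm.mul_apply, Perm.mul_apply, hA σ e ?_ x hx,
      hB σ e ?_ _ (Finset.mem_image_of_mem _ hx)]
    · exact fun i x hx hx' => h i x (Finset.mem_union_right _ hx) (Finset.mem_union_right _ hx')
    · exact fun i x hx hx' => h i x (Finset.mem_union_left _ hx) (Finset.mem_union_left _ hx')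

/-- The finite set is enlarged so that the partial maps of the generators on it determine each `γ ∈
T` on `F`; finiteness of `T` keeps the enlarged set finite. -/
theorem isFinitelyRealizable_of_isFreeGroup {Γ V : Type*} [Group Γ] [IsFreeGroup Γ] [LinearOrder V]
    (G : SimpleGraph V) (π : Γ →* (G ≃g G)) (F : Finset V) (T : Finset Γ) :
    IsFinitelyRealizable G F {t : Γ × V × V | t.1 ∈ T ∧ t.2.1 ∈ F ∧ π t.1 t.2.1 = t.2.2} := by
  classical
  rcases F.eq_empty_or_nonempty with rfl | hF
  · exact .of_finite (Y := Unit) ⊥ 1 (fun _ => ⟨⟩) (by simp) (by simp) (by simp) (by simp)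
  have b := IsFreeGroup.basis Γ
  let π' : Γ →* Perm V :=
    { toFun γ := (π γ).toEquiv
      map_one' := by rw [map_one]; rfl
      map_mul' γ δ := by rw [map_mul]; rfl }
  choose A hA using fun γ => b.exists_finset_equivariant π' γ F
  obtain ⟨Y, _, H, σ, e, hσ, inj, adj, he⟩ := b.exists_finite_action G π (F ∪ T.biUnion A)
    (hF.mono Finset.subset_union_left)
  refine .of_finite H σ e hσ (inj.mono (by simp)) (fun x hx y hy =>
    adj x (Finset.mem_union_left _ hx) y (Finset.mem_union_left _ hy)) ?_
  rintro ⟨γ, x, y⟩ ⟨hγ, hx, hy⟩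
  have hsub : A γ ⊆ F ∪ T.biUnion A :=
    (Finset.subset_biUnion_of_mem A hγ).trans Finset.subset_union_right
  exact hA γ σ e (fun i x hx hx' => he i x (hsub hx) (hsub hx')) x hx |>.trans (congrArg e hy)

/-! ### The extension property and uniqueness of the random graph -/

namespace SimpleGraph

variable {α β : Type*}

/-- The extension property that characterizes the random graph among countable graphs. -/
def HasExtensionProperty (G : SimpleGraph α) : Prop :=
  ∀ E A : Finset α, ∃ z ∉ E, ∀ x ∈ E, G.Adj z x ↔ x ∈ A

/-- A finite relation between the vertices of two graphs that is the graph of an isomorphism of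
induced subgraphs. -/
def IsPartialIso (G : SimpleGraph α) (H : SimpleGraph β) (f : Set (α × β)) : Prop :=
  ∀ p ∈ f, ∀ q ∈ f, (p.1 = q.1 ↔ p.2 = q.2) ∧ (G.Adj p.1 q.1 ↔ H.Adj p.2 q.2)

theorem IsPartialIso.exists_insert [DecidableEq α] [DecidableEq β] {G : SimpleGraph α}
    {H : SimpleGraph β} (hH : H.HasExtensionProperty) {f : Finset (α × β)}
    (hf : IsPartialIso G H (f : Set (α × β))) (a : α) :
    ∃ b, IsPartialIso G H (insert (a, b) f : Finset (α × β)) := by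
  classical
  by_cases ha : ∃ b, (a, b) ∈ f
  · obtain ⟨b, hb⟩ := ha
    exact ⟨b, by rwa [Finset.insert_eq_of_mem hb]⟩
  push Not at ha
  obtain ⟨b, hb, h⟩ := hH (f.image Prod.snd) ((f.filter fun p => G.Adj a p.1).image Prod.snd)
  have hne : ∀ p ∈ f, a ≠ p.1 ∧ b ≠ p.2 := fun p hp =>
    ⟨fun h => ha p.2 (h ▸ hp), fun h => hb (h ▸ Finset.mem_image_of_mem _ hp)⟩
  have hadj : ∀ p ∈ f, G.Adj a p.1 ↔ H.Adj b p.2 := by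
    intro p hp
    rw [h _ (Finset.mem_image_of_mem _ hp), Finset.mem_image]
    constructor
    · exact fun hap => ⟨p, Finset.mem_filter.2 ⟨hp, hap⟩, rfl⟩
    · rintro ⟨q, hq, hqp⟩
      rw [Finset.mem_filter] at hq
      rw [← (hf q hq.1 p hp).1.2 hqp]
      exact hq.2
  refine ⟨b, fun p hp q hq => ?_⟩
  rw [Finset.mem_coe, Finset.mem_insert] at hp hq
  rcases hp with rfl | hp <;> rcases hq with rfl | hq
  · simp
  · simp [hne q hq, hadj q hq]
  · simp [(hne p hp).1.symm, (hne p hp).2.symm, G.adj_comm p.1, H.adj_comm p.2, hadj p hp]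
  · exact hf p hp q hq

theorem IsPartialIso.image_swap {G : SimpleGraph α} {H : SimpleGraph β} {f : Set (α × β)}
    (hf : IsPartialIso G H f) : IsPartialIso H G (Prod.swap '' f) := by
  rintro _ ⟨p, hp, rfl⟩ _ ⟨q, hq, rfl⟩
  exact ⟨(hf p hp q hq).1.symm, (hf p hp q hq).2.symm⟩

/-- Countable graphs with the extension property are isomorphic. -/
theorem HasExtensionProperty.nonempty_iso [Countable α] [Countable β] {G : SimpleGraph α}
    {H : SimpleGraph β} (hG : G.HasExtensionProperty) (hH : H.HasExtensionProperty) :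
    Nonempty (G ≃g H) := by
  classical
  let P := {f : Finset (α × β) // IsPartialIso G H (f : Set (α × β))}
  have : Nonempty P := ⟨⟨∅, by simp [IsPartialIso]⟩⟩
  -- Back and forth: finite partial isomorphisms with a given vertex in the domain, or in the range,
  -- are cofinal.
  obtain ⟨u, hu, hD⟩ := exists_monotone_meeting_cofinal
    (Sum.elim (fun a : α => {f : P | ∃ b, (a, b) ∈ f.1}) fun b : β => {f : P | ∃ a, (a, b) ∈ f.1})
    (by
      rintro (a | b) ⟨f, hf⟩
      · obtain ⟨b, hb⟩ := hf.exists_insert hH a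
        exact ⟨⟨_, hb⟩, Finset.subset_insert _ _, b, Finset.mem_insert_self _ _⟩
      · have hf' : IsPartialIso H G (f.image Prod.swap : Finset (β × α)) := by
          simpa using hf.image_swap
        obtain ⟨a, ha⟩ := hf'.exists_insert hG b
        refine ⟨⟨insert (a, b) f, ?_⟩, Finset.subset_insert _ _, a, Finset.mem_insert_self _ _⟩
        have := ha.image_swap
        simpa [Set.image_insert_eq, Set.image_image] using this)
  have huv : ∀ p q : α × β, (∃ n, p ∈ (u n).1) → (∃ n, q ∈ (u n).1) →
      (p.1 = q.1 ↔ p.2 = q.2) ∧ (G.Adj p.1 q.1 ↔ H.Adj p.2 q.2) := by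
    rintro p q ⟨n, hn⟩ ⟨m, hm⟩
    exact (u (max n m)).2 p (hu (le_max_left n m) hn) q (hu (le_max_right n m) hm)
  have hl : ∀ a, ∃ b n, (a, b) ∈ (u n).1 := fun a => let ⟨n, b, h⟩ := hD (.inl a); ⟨b, n, h⟩
  have hr : ∀ b, ∃ a n, (a, b) ∈ (u n).1 := fun b => let ⟨n, a, h⟩ := hD (.inr b); ⟨a, n, h⟩
  choose f hf using hl
  choose g hg using hr
  exact ⟨⟨⟨f, g, fun a => (huv (_, _) (_, _) (hg (f a)) (hf a)).1.2 rfl,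
    fun b => (huv (_, _) (_, _) (hf (g b)) (hg b)).1.1 rfl⟩,
    fun {a b} => (huv (_, _) (_, _) (hf a) (hf b)).2.symm⟩⟩

/-- Embeddings of graphs as embeddings of structures. -/
def structureEmbedding (G : SimpleGraph α) (H : SimpleGraph β) (f : G ↪g H) :
    letI := G.structure
    letI := H.structure
    α ↪[Language.graph] β :=
  letI := G.structure
  letI := H.structure
  { toEmbedding := f.toEmbedding
    map_fun' := fun {_} F => F.elim
    map_rel' := fun {n} r _ => match n, r with
      | _, .adj => f.map_adj_iff }

end SimpleGraph

/-- The one-point extension `T` of the graph on `E` is finite, so it embeds in `R`; ultrahomogeneity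
yields an embedding that fixes `E`, and the image of `none` is the required vertex. -/
theorem IsRandomGraph.hasExtensionProperty {V : Type u} {R : SimpleGraph V}
    (hR : IsRandomGraph R) : R.HasExtensionProperty := by
  classical
  let _ : Language.graph.Structure V := R.structure
  obtain ⟨_, hlim⟩ := hR
  intro E A
  let S : SimpleGraph E := R.comap (↑)
  let T : SimpleGraph (Option E) :=
    { Adj
        | some x, some y => R.Adj x y
        | some x, none => (x : V) ∈ A
        | none, some x => (x : V) ∈ A
        | none, none => False
      symm := ⟨by
        rintro (_ | x) (_ | y) h
        exacts [h, h, h, h.symm]⟩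
      loopless := ⟨by
        rintro (_ | x) h
        exacts [h, R.loopless.irrefl _ h]⟩ }
  let _ : Language.graph.Structure E := S.structure
  let _ : Language.graph.Structure (Option E) := T.structure
  have hT : Nonempty (Option E ↪[Language.graph] V) := by
    have : CategoryTheory.Bundled.of (c := Language.graph.Structure) (Option E) ∈ Language.graph.age V := by
      rw [hlim.age]
      exact ⟨inferInstanceAs (Finite (Option E)), Language.simpleGraph_model T⟩
    exact this.2
  obtain ⟨f, hf⟩ := hlim.ultrahomogeneous.extend_embedding
    (Language.Structure.FG.of_finite (M := E))
    (S.structureEmbedding R ⟨⟨_, Subtype.val_injective⟩, Iff.rfl⟩)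
    (S.structureEmbedding T ⟨⟨some, Option.some_injective _⟩, Iff.rfl⟩)
  have hf' : ∀ x : E, f (some x) = x := fun x => (DFunLike.congr_fun hf x).symm
  refine ⟨f none, fun h => ?_, fun x hx => ?_⟩
  · have := f.injective ((hf' ⟨_, h⟩).trans rfl)
    cases this
  · have := f.map_rel Language.adj ![none, some ⟨x, hx⟩]
    change R.Adj (f none) (f (some ⟨x, hx⟩)) ↔ x ∈ A at this
    rwa [hf'] at this

/-! ### Topology and conclusion -/

theorem exists_finset_of_isOpen {V : Type*} {R : SimpleGraph V} {U : Set (R ≃g R)} (hU : IsOpen U)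
    {g : R ≃g R} (hg : g ∈ U) : ∃ F : Finset V, ∀ g' : R ≃g R, (∀ x ∈ F, g' x = g x) → g' ∈ U := by
  obtain ⟨W, hW, rfl⟩ := hU
  obtain ⟨F, u, hu, huW⟩ := (@isOpen_pi_iff V (fun _ => V) (fun _ => ⊥) W).1 hW _ hg
  refine ⟨F, fun g' h => huW fun x hx => ?_⟩
  have : g x ∈ u x := (hu x hx).2
  rw [← h x hx] at this
  exact this

theorem RepSpace.dense_range {Γ V ι : Type*} [Group Γ] {R : SimpleGraph V}
    (f : ι → RepSpace Γ (R ≃g R)) (hf : ∀ (π : RepSpace Γ (R ≃g R)) (T : Finset Γ) (F : Finset V),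
      ∃ i, ∀ γ ∈ T, ∀ x ∈ F, f i γ x = π γ x) : Dense (Set.range f) := by
  classical
  intro π
  rw [mem_closure_iff]
  rintro _ ⟨W, hW, rfl⟩ hπ
  obtain ⟨T, u, hu, huW⟩ := isOpen_pi_iff.1 hW _ hπ
  have key : ∀ γ, ∃ F : Finset V, γ ∈ T → ∀ g : R ≃g R, (∀ x ∈ F, g x = π γ x) → g ∈ u γ := by
    intro γ
    by_cases hγ : γ ∈ T
    · obtain ⟨F, hF⟩ := exists_finset_of_isOpen (hu γ hγ).1 (hu γ hγ).2
      exact ⟨F, fun _ => hF⟩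
    · exact ⟨∅, fun h => absurd h hγ⟩
  choose F hF using key
  obtain ⟨i, hi⟩ := hf π T (T.biUnion F)
  exact ⟨f i, huW fun γ hγ => hF γ hγ _ fun x hx =>
    hi γ hγ x (Finset.mem_biUnion.2 ⟨γ, hγ, hx⟩), i, rfl⟩

theorem Group.countable_of_fg (Γ : Type*) [Group Γ] [Group.FG Γ] : Countable Γ := by
  obtain ⟨S, hS, f, hf⟩ := Group.fg_iff_exists_freeGroup_hom_surjective_finite.1 ‹Group.FG Γ›
  have : Countable (FreeGroup S) := inferInstance
  exact hf.countable

/-- Finite pieces of actions of `Γ` on graphs on the integers are contained in actions on finite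
graphs. -/
theorem isFinitelyRealizable_of_commute_or_isFreeGroup {Γ V : Type*} [Group Γ] [Group.FG Γ]
    [LinearOrder V] (hΓ : (∀ a b : Γ, a * b = b * a) ∨ IsFreeGroup Γ) (G : SimpleGraph V)
    (π : Γ →* (G ≃g G)) (F : Finset V) (T : Finset Γ) :
    IsFinitelyRealizable G F {t : Γ × V × V | t.1 ∈ T ∧ t.2.1 ∈ F ∧ π t.1 t.2.1 = t.2.2} := by
  rcases hΓ with hΓ | hΓ
  · let _ : CommGroup Γ := { ‹Group Γ› with mul_comm := hΓ }
    obtain ⟨n, H, σ, e, hσ, inj, adj, he⟩ := isFinitelyRealizable_of_commGroup G π F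
    exact ⟨n, H, σ, e, hσ, inj, adj, fun t ht => he t ht.2.2⟩
  · exact isFinitelyRealizable_of_isFreeGroup G π F T

/-- Translation by an integer as an automorphism of a difference graph. -/
def differenceGraphShift (S : Set ℕ) (k : ℤ) : differenceGraph S ≃g differenceGraph S :=
  ⟨Equiv.addRight k, differenceGraph_adj_add_right _ _ k⟩

theorem differenceGraphShift_one_zpow (S : Set ℕ) (k x : ℤ) :
    (differenceGraphShift S 1 ^ k) x = x + k := by
  let φ : Multiplicative ℤ →* (differenceGraph S ≃g differenceGraph S) :=
    { toFun k := differenceGraphShift S k.toAdd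
      map_one' := by ext x; exact add_zero x
      map_mul' k l := by
        ext x
        change x + (k.toAdd + l.toAdd) = x + l.toAdd + k.toAdd
        ring }
  have h : differenceGraphShift S 1 ^ k = φ (Multiplicative.ofAdd 1 ^ k) := (map_zpow φ _ k).symm
  rw [h, ← ofAdd_zsmul, smul_eq_mul, mul_one]
  rfl

theorem exists_differenceGraph_dense_orbit {Γ : Type*} [Group Γ] [Group.FG Γ]
    (hΓ : (∀ a b : Γ, a * b = b * a) ∨ IsFreeGroup Γ) :
    ∃ (S : Set ℕ) (π : Γ →* (differenceGraph S ≃g differenceGraph S)),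
      (differenceGraph S).HasExtensionProperty ∧
      ∀ (π' : Γ →* (differenceGraph S ≃g differenceGraph S)) (T : Finset Γ) (F : Finset ℤ),
        ∃ k : ℤ, ∀ γ ∈ T, ∀ x ∈ F, π γ (x + k) = π' γ x + k := by
  classical
  have := Group.countable_of_fg Γ
  obtain ⟨S, π, hS, hπ⟩ := GraphActionApprox.exists_differenceGraph_action (Γ := Γ)
  refine ⟨S, π, hS, fun π' T F => ?_⟩
  let h : Finset (Γ × ℤ × ℤ) := (T ×ˢ F).image fun p => (p.1, p.2, π' p.1 p.2)
  -- A pattern must contain the targets of its partial maps, so the images of `F` are added.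
  let F' : Finset ℤ := F ∪ h.image fun t => t.2.2
  have hmem : ∀ γ ∈ T, ∀ x ∈ F, (γ, x, π' γ x) ∈ h := fun γ hγ x hx =>
    Finset.mem_image.2 ⟨(γ, x), Finset.mem_product.2 ⟨hγ, hx⟩, rfl⟩
  have hh : ∀ t ∈ h, t.1 ∈ T ∧ t.2.1 ∈ F ∧ π' t.1 t.2.1 = t.2.2 := by
    intro t ht
    obtain ⟨p, hp, rfl⟩ := Finset.mem_image.1 ht
    exact ⟨(Finset.mem_product.1 hp).1, (Finset.mem_product.1 hp).2, rfl⟩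
  obtain ⟨n, H, σ, e, hσ, inj, adj, he⟩ :=
    isFinitelyRealizable_of_commute_or_isFreeGroup hΓ (differenceGraph S) π' F' T
  obtain ⟨k, hk⟩ := hπ F' h (fun t ht => ⟨Finset.mem_union_left _ (hh t ht).2.1,
    Finset.mem_union_right _ (Finset.mem_image_of_mem _ ht)⟩)
    ⟨n, H, σ, e, hσ, inj, adj, fun t ht => he t
      ⟨(hh t ht).1, Finset.mem_union_left _ (hh t ht).2.1, (hh t ht).2.2⟩⟩
  exact ⟨k, fun γ hγ x hx => hk _ (hmem γ hγ x hx)⟩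

/-- An isomorphism of graphs induces an isomorphism of their automorphism groups. -/
def SimpleGraph.Iso.autCongr {V W : Type*} {G : SimpleGraph V} {H : SimpleGraph W} (φ : G ≃g H) :
    (G ≃g G) ≃* (H ≃g H) where
  toFun g := (φ.symm.trans g).trans φ
  invFun g := (φ.trans g).trans φ.symm
  left_inv g := by ext x; simp
  right_inv g := by ext x; simp
  map_mul' g h := by ext x; simp

@[simp]
theorem SimpleGraph.Iso.autCongr_apply {V W : Type*} {G : SimpleGraph V} {H : SimpleGraph W}
    (φ : G ≃g H) (g : G ≃g G) (x : W) : φ.autCongr g x = φ (g (φ.symm x)) := rfl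

theorem mainTheorem7 {V Γ : Type*} (R : SimpleGraph V) (hR : IsRandomGraph R)
    [Group Γ] [Group.FG Γ] (hΓ : (∀ a b : Γ, a * b = b * a) ∨ IsFreeGroup Γ) :
    ∃ g : R ≃g R, IsTransitiveAut g ∧
      ∃ π : RepSpace Γ (R ≃g R), RepSpace.IsCyclicallyDenseVia g π := by
  classical
  obtain ⟨S, π, hS, hπ⟩ := exists_differenceGraph_dense_orbit hΓ
  obtain ⟨φ⟩ : Nonempty (differenceGraph S ≃g R) := by
    have := hR.choose
    exact hS.nonempty_iso hR.hasExtensionProperty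
  let g : R ≃g R := φ.autCongr (differenceGraphShift S 1)
  have hg : ∀ (k : ℤ) x, (g ^ k) x = φ (φ.symm x + k) := by
    intro k x
    rw [← map_zpow, SimpleGraph.Iso.autCongr_apply, differenceGraphShift_one_zpow]
  refine ⟨g, fun x y => ⟨φ.symm y - φ.symm x, ?_⟩, (φ.autCongr.toMonoidHom.comp π : Γ →* (R ≃g R)),
    RepSpace.dense_range _ fun π' T F => ?_⟩
  · rw [hg, add_sub_cancel, φ.apply_symm_apply]
  · obtain ⟨k, hk⟩ := hπ (φ.autCongr.symm.toMonoidHom.comp (π' : Γ →* (R ≃g R))) T (F.image φ.symm)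
    -- The sign is negative because conjugation by `g ^ (-k)` evaluates `π` at the point shifted by
    -- `+k`.
    refine ⟨-k, fun γ hγ x hx => ?_⟩
    change (g ^ (-k)) (φ (π γ (φ.symm ((g ^ (-k))⁻¹ x)))) = π' γ x
    rw [← zpow_neg, neg_neg, hg, hg, φ.symm_apply_apply, φ.symm_apply_apply,
      hk γ hγ _ (Finset.mem_image_of_mem _ hx), add_neg_cancel_right]
    change φ (φ.symm (π' γ (φ (φ.symm x)))) = π' γ x
    rw [φ.apply_symm_apply, φ.apply_symm_apply]
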